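/- For a matrix $K\in\mathbb{R}^{p\times d}$, $K\neq 0$, let $\kappa_K=\lambda_{\max}(K^\top K)/\lambda_{\min^+}(K^\top K)$, where $\lambda_{\min^+}$ is the smallest positive eigenvalue. For a differentiable $P:\mathbb{R}^d\to\mathbb{R}$ and constants $L_P,\mu_P>0$, APAPC for the problem $\min_u P(u)$ s.t. $Ku=c$, started at $u^0$, is the following method. Put $\kappa_P=L_P/\mu_P$, $\tau=\min\{1,\tfrac12\sqrt{\kappa_K/\kappa_P}\}$, $\eta=\frac{1}{4\tau L_P}$, $\theta=\frac{1}{\eta\lambda_{\max}(K^\top K)}$, $\alpha=\mu_P$, $u_f^0=u^0$, $z^0=0$, and for $k=0,1,2,\dots$ $$\begin{aligned} u_g^k&=\tau u^k+(1-\tau)u_f^k,\\ u^{k+1/2}&=(1+\eta\alpha)^{-1}\big(u^k-\eta(\nabla P(u_g^k)-\alpha u_g^k+z^k)\big),\\ z^{k+1}&=z^k+\theta K^\top(Ku^{k+1/2}-c),\\ u^{k+1}&=(1+\eta\alpha)^{-1}\big(u^k-\eta(\nabla P(u_g^k)-\alpha u_g^k+z^{k+1})\big),\\ u_f^{k+1}&=u_g^k+\tfrac{2\tau}{2-\tau}(u^{k+1}-u^k).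 \end{aligned}$$ Statement. There is an absolute constant $C>0$ with the following property. Let $K\in\mathbb{R}^{p\times d}$, $K\ne0$, let $c\in\operatorname{Im}K$, and let $h:\mathbb{R}^d\to\mathbb{R}$ be convex (not necessarily strongly convex) and $L$-smooth with $L>0$, that is, differentiable with $h(y)\le h(x)+\langle\nabla h(x),y-x\rangle+\frac L2\|y-x\|_2^2$ for all $x,y$. Let $R>0$ and $u^0\in\mathbb{R}^d$. Then there is $\varepsilon_0>0$ (depending on $K,c,h,L,R,u^0$) such that for every $0<\varepsilon<\varepsilon_0$, with $\mu=\varepsilon/R^2$, the regularized problem $$\min_{u\in\mathbb{R}^d}\; h_\mu(u)=h(u)+\tfrac{\mu}{2}\|u\|_2^2\quad\text{s.t. } Ku=c$$ has a unique solution $u^*_\mu$, and for every integer $$N\ \ge\ C\sqrt{\frac{\kappa_K L R^2}{\varepsilon}}\;\ln\frac1\varepsilon$$ the iterate $\hat u=u^N$ of APAPC applied to this problem (that is, $P=h_\mu$, $L_P=L+\mu$, $\mu_P=\mu$) started at $u^0$ satisfies $$\|\hat u-u^*_\mu\|_2^2\le\varepsilon .$$ Moreover, for every such $N$, $h(\hat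 u)-h(u^*)\le\varepsilon$ for every solution $u^*$ of the original problem $\min_{u} h(u)$ s.t. $Ku=c$ with $\|u^*\|_2^2\le R^2$. -/

import Mathlib

open scoped Matrix

noncomputable section

/-- Largest eigenvalue of a real square matrix. -/
def lamMax {d : ℕ} (A : Matrix (Fin d) (Fin d) ℝ) : ℝ :=
  sSup {t : ℝ | Module.End.HasEigenvalue (Matrix.toLin' A) t}

/-- Smallest positive eigenvalue of a real square matrix. -/
def lamMinPos {d : ℕ} (A : Matrix (Fin d) (Fin d) ℝ) : ℝ :=
  sInf {t : ℝ | 0 < t ∧ Module.End.HasEigenvalue (Matrix.toLin' A) t}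

/-- The condition number `κ_K = λ_max(Kᵀ K) / λ_min⁺(Kᵀ K)`. -/
def condNumber {p d : ℕ} (K : Matrix (Fin p) (Fin d) ℝ) : ℝ :=
  lamMax (Kᵀ * K) / lamMinPos (Kᵀ * K)

/-- `h` is differentiable and `h y ≤ h x + ⟪∇ h x, y - x⟫ + L / 2 * ‖y - x‖ ^ 2`. -/
def IsLSmooth {d : ℕ} (L : ℝ) (h : EuclideanSpace ℝ (Fin d) → ℝ) : Prop :=
  Differentiable ℝ h ∧
    ∀ x y, h y ≤ h x + inner ℝ (gradient h x) (y - x) + L / 2 * ‖y - x‖ ^ 2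

/-- `u` solves the problem: minimize `P` subject to `K u = c`. -/
def IsAffineSolution {p d : ℕ} (P : EuclideanSpace ℝ (Fin d) → ℝ)
    (K : Matrix (Fin p) (Fin d) ℝ) (c : EuclideanSpace ℝ (Fin p))
    (u : EuclideanSpace ℝ (Fin d)) : Prop :=
  Matrix.toEuclideanLin K u = c ∧ ∀ v, Matrix.toEuclideanLin K v = c → P u ≤ P v

/-- The regularized objective `h u + μ ‖u‖² / 2`. -/
def regularized {d : ℕ} (h : EuclideanSpace ℝ (Fin d) → ℝ) (μ : ℝ)
    (u : EuclideanSpace ℝ (Fin d)) : ℝ :=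
  h u + μ * ‖u‖ ^ 2 / 2

/-- The variables `(u^k, u_f^k, z^k)` carried from one APAPC iteration to the next. -/
structure APAPCState (d : ℕ) where
  u : EuclideanSpace ℝ (Fin d)
  uf : EuclideanSpace ℝ (Fin d)
  z : EuclideanSpace ℝ (Fin d)

/-- One iteration of APAPC for: minimize `P` subject to `K u = c`. -/
def apapcStep {p d : ℕ} (P : EuclideanSpace ℝ (Fin d) → ℝ)
    (K : Matrix (Fin p) (Fin d) ℝ) (c : EuclideanSpace ℝ (Fin p))
    (η θ α τ : ℝ) (s : APAPCState d) : APAPCState d :=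
  let ug := τ • s.u + (1 - τ) • s.uf
  let uhalf := (1 + η * α)⁻¹ • (s.u - η • (gradient P ug - α • ug + s.z))
  let z' := s.z + θ • Matrix.toEuclideanLin Kᵀ (Matrix.toEuclideanLin K uhalf - c)
  let u' := (1 + η * α)⁻¹ • (s.u - η • (gradient P ug - α • ug + z'))
  let uf' := ug + (2 * τ / (2 - τ)) • (u' - s.u)
  ⟨u', uf', z'⟩

/-- The state of APAPC after `k` iterations, from `u^0 = u_f^0 = u0` and `z^0 = 0`. -/
def apapcState {p d : ℕ} (P : EuclideanSpace ℝ (Fin d) → ℝ)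
    (K : Matrix (Fin p) (Fin d) ℝ) (c : EuclideanSpace ℝ (Fin p))
    (η θ α τ : ℝ) (u0 : EuclideanSpace ℝ (Fin d)) (k : ℕ) : APAPCState d :=
  (apapcStep P K c η θ α τ)^[k] ⟨u0, u0, 0⟩

/-- `τ = min {1, (1/2) √(κ_K / κ_P)}` with `κ_P = LP / μP`. -/
def apapcTau {p d : ℕ} (K : Matrix (Fin p) (Fin d) ℝ) (LP μP : ℝ) : ℝ :=
  min 1 (1 / 2 * Real.sqrt (condNumber K / (LP / μP)))

/-- `η = 1 / (4 τ LP)`. -/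
def apapcEta {p d : ℕ} (K : Matrix (Fin p) (Fin d) ℝ) (LP μP : ℝ) : ℝ :=
  1 / (4 * apapcTau K LP μP * LP)

/-- `θ = 1 / (η λ_max(Kᵀ K))`. -/
def apapcTheta {p d : ℕ} (K : Matrix (Fin p) (Fin d) ℝ) (LP μP : ℝ) : ℝ :=
  1 / (apapcEta K LP μP * lamMax (Kᵀ * K))

/-- The iterate `u^k` of APAPC for an `LP`-smooth and `μP`-strongly convex objective `P`,
run with the parameters `τ, η, θ` above and `α = μP`. -/
def apapcIterate {p d : ℕ} (P : EuclideanSpace ℝ (Fin d) → ℝ)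
    (K : Matrix (Fin p) (Fin d) ℝ) (c : EuclideanSpace ℝ (Fin p))
    (LP μP : ℝ) (u0 : EuclideanSpace ℝ (Fin d)) (k : ℕ) : EuclideanSpace ℝ (Fin d) :=
  (apapcState P K c (apapcEta K LP μP) (apapcTheta K LP μP) μP (apapcTau K LP μP) u0 k).u

end

/-! Since α = μ, each step uses the gradient of h alone and treats the quadratic term implicitly.
With z = Kᵀy and a multiplier y* at u*_μ, a Lyapunov function of the primal error, the dual error
and the Bregman divergence of h at u_f shrinks by a factor 1 + δ per step, δ = 1/(6√(κ_K κ_P))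
(`apapc_descent`, `apapcLyapunov_contraction`). The dual error contracts because it stays in Im K,
where Kᵀ is bounded below through λ_min⁺ (`lamMinPos_mul_sq_norm_le`).

The original problem need not have a solution, so u*_μ may be unbounded as μ → 0. It grows at most
like 1/μ (`exists_regularized_bound`), so the initial Lyapunov value is O(ε⁻³). With C = 180 the N
steps gain a factor ε¹⁰, and the squared distance is at most ε⁶ for small ε. This outweighs the
O(1/ε) gradient at u*_μ, and the bias of the regularization costs at most ε/2. Small ε also forces
κ_K ≤ κ_P, which settles the minimum defining τ. -/

/-! ### Convex smooth functions -/

section SmoothConvex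

variable {E : Type*} [NormedAddCommGroup E] [InnerProductSpace ℝ E] [CompleteSpace E]

/-- First-order characterization of convexity. -/
theorem ConvexOn.add_inner_gradient_le {h : E → ℝ} (hc : ConvexOn ℝ Set.univ h)
    (hd : Differentiable ℝ h) (x y : E) :
    h x + inner ℝ (gradient h x) (y - x) ≤ h y := by
  have hg : HasDerivAt (h ∘ (AffineMap.lineMap x y : ℝ →ᵃ[ℝ] E))
      (inner ℝ (gradient h x) (y - x)) 0 := by
    have h1 : HasFDerivAt h (InnerProductSpace.toDual ℝ E (gradient h x))
        (AffineMap.lineMap x y (0 : ℝ)) := by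
      rw [AffineMap.lineMap_apply_zero]
      exact (hd x).hasGradientAt.hasFDerivAt
    exact h1.comp_hasDerivAt (0 : ℝ) AffineMap.hasDerivAt_lineMap
  have hline : ConvexOn ℝ Set.univ (h ∘ (AffineMap.lineMap x y : ℝ →ᵃ[ℝ] E)) :=
    hc.comp_affineMap (AffineMap.lineMap x y : ℝ →ᵃ[ℝ] E)
  have := hline.le_slope_of_hasDerivAt (Set.mem_univ _) (Set.mem_univ _) one_pos hg
  rw [slope_def_field] at this
  simp only [Function.comp, AffineMap.lineMap_apply_zero, AffineMap.lineMap_apply_one, sub_zero,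
    div_one] at this
  linarith

/-- The quadratic lower bound of a convex function with quadratic upper bounds. -/
theorem ConvexOn.add_sq_norm_gradient_sub_le {h : E → ℝ} {L : ℝ} (hL : 0 < L)
    (hc : ConvexOn ℝ Set.univ h) (hd : Differentiable ℝ h)
    (hs : ∀ x y, h y ≤ h x + inner ℝ (gradient h x) (y - x) + L / 2 * ‖y - x‖ ^ 2) (x y : E) :
    h x + inner ℝ (gradient h x) (y - x) + 1 / (2 * L) * ‖gradient h y - gradient h x‖ ^ 2
      ≤ h y := by
  set g := gradient h y - gradient h x with hg
  -- The test point minimizes the quadratic upper model at y of h minus its linear part at x.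
  have h1 := hs y (y - (1 / L) • g)
  have h2 := hc.add_inner_gradient_le hd x (y - (1 / L) • g)
  have e1 : y - (1 / L) • g - y = -((1 / L) • g) := by abel
  have e2 : y - (1 / L) • g - x = (y - x) - (1 / L) • g := by abel
  rw [e1, norm_neg, norm_smul, inner_neg_right, inner_smul_right, mul_pow, Real.norm_eq_abs,
    sq_abs] at h1
  rw [e2, inner_sub_right, inner_smul_right] at h2
  have e3 : inner ℝ (gradient h y) g - inner ℝ (gradient h x) g = ‖g‖ ^ 2 := by
    rw [← inner_sub_left, ← hg, real_inner_self_eq_norm_sq]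
  have e4 : L / 2 * ((1 / L) ^ 2 * ‖g‖ ^ 2) = 1 / (2 * L) * ‖g‖ ^ 2 := by
    field_simp
  have e5 : 1 / L * inner ℝ (gradient h y) g - 1 / L * inner ℝ (gradient h x) g
      = 2 * (1 / (2 * L) * ‖g‖ ^ 2) := by
    rw [← mul_sub, e3]; field_simp
  linarith

/-- Adding the quadratic lower bound for (x, y) and (y, x) gives cocoercivity; Cauchy–Schwarz then
gives the Lipschitz bound. -/
theorem ConvexOn.norm_gradient_sub_le {h : E → ℝ} {L : ℝ} (hL : 0 < L)
    (hc : ConvexOn ℝ Set.univ h) (hd : Differentiable ℝ h)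
    (hs : ∀ x y, h y ≤ h x + inner ℝ (gradient h x) (y - x) + L / 2 * ‖y - x‖ ^ 2) (x y : E) :
    ‖gradient h y - gradient h x‖ ≤ L * ‖y - x‖ := by
  have h1 := hc.add_sq_norm_gradient_sub_le hL hd hs x y
  have h2 := hc.add_sq_norm_gradient_sub_le hL hd hs y x
  rw [norm_sub_rev, ← neg_sub y x, inner_neg_right] at h2
  set g := gradient h y - gradient h x with hg
  have h3 : 1 / L * ‖g‖ ^ 2 ≤ ‖g‖ * ‖y - x‖ := by
    have : inner ℝ g (y - x) = inner ℝ (gradient h y) (y - x) - inner ℝ (gradient h x) (y - x) := by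
      rw [hg, inner_sub_left]
    have h4 := real_inner_le_norm g (y - x)
    have e : 1 / L * ‖g‖ ^ 2 = 2 * (1 / (2 * L) * ‖g‖ ^ 2) := by field_simp
    linarith
  rcases (norm_nonneg g).eq_or_lt with h0 | h0
  · rw [← h0]; positivity
  · have : ‖g‖ * ‖g‖ ≤ ‖g‖ * (L * ‖y - x‖) := by
      have := mul_le_mul_of_nonneg_left h3 hL.le
      field_simp at this
      nlinarith
    exact le_of_mul_le_mul_left this h0

end SmoothConvex

theorem gradient_regularized {d : ℕ} {h : EuclideanSpace ℝ (Fin d) → ℝ}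
    (hd : Differentiable ℝ h) (μ : ℝ) (x : EuclideanSpace ℝ (Fin d)) :
    gradient (regularized h μ) x = gradient h x + μ • x := by
  apply HasGradientAt.gradient
  rw [hasGradientAt_iff_hasFDerivAt]
  have h1 := (hd x).hasGradientAt.hasFDerivAt
  have h2 := ((hasStrictFDerivAt_norm_sq x).hasFDerivAt.const_mul μ).mul_const (2⁻¹ : ℝ)
  have h3 := h1.add h2
  refine (h3.congr_fderiv ?_).congr_of_eventuallyEq ?_
  · ext v
    simp
    ring
  · exact Filter.Eventually.of_forall fun u => by
      simp [regularized, div_eq_mul_inv]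

/-! ### Spectral bounds for KᵀK -/

section Spectral

variable {p d : ℕ} (K : Matrix (Fin p) (Fin d) ℝ)

theorem inner_toEuclideanLin_transpose (x : EuclideanSpace ℝ (Fin d))
    (y : EuclideanSpace ℝ (Fin p)) :
    inner ℝ (Matrix.toEuclideanLin Kᵀ y) x = inner ℝ y (Matrix.toEuclideanLin K x) := by
  have : Kᵀ = Kᴴ := (Matrix.conjTranspose_eq_transpose_of_trivial K).symm
  rw [this, Matrix.toEuclideanLin_conjTranspose_eq_adjoint, LinearMap.adjoint_inner_left]

/-- One eigenbasis of KᵀK diagonalizes both quadratic forms, so the spectral bounds reduce to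
comparing coefficients. -/
theorem exists_orthonormalBasis_eigenvectors_gram :
    ∃ (b : OrthonormalBasis (Fin d) ℝ (EuclideanSpace ℝ (Fin d))) (l : Fin d → ℝ),
      (∀ i, Module.End.HasEigenvalue (Matrix.toLin' (Kᵀ * K)) (l i)) ∧
      (∀ i, 0 ≤ l i) ∧
      (∀ x, ‖Matrix.toEuclideanLin K x‖ ^ 2 = ∑ i, l i * inner ℝ (b i) x ^ 2) ∧
      ∀ x, ‖Matrix.toEuclideanLin Kᵀ (Matrix.toEuclideanLin K x)‖ ^ 2
        = ∑ i, l i ^ 2 * inner ℝ (b i) x ^ 2 := by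
  set T : EuclideanSpace ℝ (Fin d) →ₗ[ℝ] EuclideanSpace ℝ (Fin d) :=
    Matrix.toEuclideanLin Kᵀ ∘ₗ Matrix.toEuclideanLin K with hTdef
  have hT : T.IsSymmetric := fun x y => by
    simp only [hTdef, LinearMap.comp_apply]
    rw [inner_toEuclideanLin_transpose, real_inner_comm, ← inner_toEuclideanLin_transpose,
      real_inner_comm]
  have hn : Module.finrank ℝ (EuclideanSpace ℝ (Fin d)) = d := by simp
  set b := hT.eigenvectorBasis hn
  set l := hT.eigenvalues hn
  have hb : ∀ i, T (b i) = l i • b i := fun i => hT.apply_eigenvectorBasis hn i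
  have hin : ∀ i x, inner ℝ (b i) (T x) = l i * inner ℝ (b i) x := fun i x => by
    rw [← hT, hb, inner_smul_left]; rfl
  have hK : ∀ x, ‖Matrix.toEuclideanLin K x‖ ^ 2 = inner ℝ x (T x) := fun x => by
    rw [← real_inner_self_eq_norm_sq, ← inner_toEuclideanLin_transpose, real_inner_comm]; rfl
  refine ⟨b, l, fun i => ?_, fun i => ?_, fun x => ?_, fun x => ?_⟩
  · refine Module.End.hasEigenvalue_of_hasEigenvector (x := (b i).ofLp) ⟨?_, ?_⟩
    · rw [Module.End.mem_eigenspace_iff]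
      have := congrArg WithLp.ofLp (hb i)
      simpa [hTdef, Matrix.toLpLin_apply, Matrix.mulVec_mulVec] using this
    · intro h0
      exact b.toBasis.ne_zero i (by simpa using h0)
  · have h1 := hK (b i)
    rw [hin, real_inner_self_eq_norm_sq, b.norm_eq_one, one_pow, mul_one] at h1
    exact h1 ▸ sq_nonneg _
  · rw [hK, ← b.sum_inner_mul_inner]
    exact Finset.sum_congr rfl fun i _ => by rw [hin, real_inner_comm]; ring
  · change ‖T x‖ ^ 2 = _
    rw [← real_inner_self_eq_norm_sq, ← b.sum_inner_mul_inner]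
    exact Finset.sum_congr rfl fun i _ => by rw [real_inner_comm, hin]; ring

theorem sq_norm_toEuclideanLin_le (x : EuclideanSpace ℝ (Fin d)) :
    ‖Matrix.toEuclideanLin K x‖ ^ 2 ≤ lamMax (Kᵀ * K) * ‖x‖ ^ 2 := by
  obtain ⟨b, l, hl, -, h1, -⟩ := exists_orthonormalBasis_eigenvectors_gram K
  rw [h1, ← b.sum_sq_inner_right x, Finset.mul_sum]
  gcongr with i
  exact le_csSup (Module.End.finite_hasEigenvalue _).bddAbove (hl i)

/-- Each eigenvalue is 0 or at least λ_min⁺. Read with y = Kx, this bounds Kᵀ from below on Im K. -/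
theorem lamMinPos_mul_sq_norm_le (x : EuclideanSpace ℝ (Fin d)) :
    lamMinPos (Kᵀ * K) * ‖Matrix.toEuclideanLin K x‖ ^ 2 ≤
      ‖Matrix.toEuclideanLin Kᵀ (Matrix.toEuclideanLin K x)‖ ^ 2 := by
  obtain ⟨b, l, hl, hl0, h1, h2⟩ := exists_orthonormalBasis_eigenvectors_gram K
  rw [h1, h2, Finset.mul_sum]
  refine Finset.sum_le_sum fun i _ => ?_
  rw [← mul_assoc]
  refine mul_le_mul_of_nonneg_right ?_ (sq_nonneg _)
  rcases (hl0 i).eq_or_lt with h0 | h0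
  · simp [← h0]
  · rw [sq]
    gcongr
    exact csInf_le ⟨0, fun t ht => ht.1.le⟩ ⟨h0, hl i⟩

variable {K}

/-- If all eigenvalues vanished, so would every ‖Kx‖. Nonemptiness keeps the `sInf` in `lamMinPos`
off its default value 0. -/
theorem exists_pos_hasEigenvalue_gram (hK : K ≠ 0) :
    ∃ t, 0 < t ∧ Module.End.HasEigenvalue (Matrix.toLin' (Kᵀ * K)) t := by
  obtain ⟨b, l, hl, hl0, h1, -⟩ := exists_orthonormalBasis_eigenvectors_gram K
  by_contra! hcon
  apply hK
  have hz : ∀ i, l i = 0 := fun i =>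
    le_antisymm (not_lt.1 fun hi => hcon _ hi (hl i)) (hl0 i)
  have : Matrix.toEuclideanLin K = 0 := by
    ext1 x
    have := h1 x
    simpa [hz] using this
  simpa using this

theorem lamMinPos_gram_pos (hK : K ≠ 0) : 0 < lamMinPos (Kᵀ * K) := by
  have hfin : {t : ℝ | 0 < t ∧ Module.End.HasEigenvalue (Matrix.toLin' (Kᵀ * K)) t}.Finite :=
    (Module.End.finite_hasEigenvalue _).subset fun t ht => ht.2
  have hne : {t : ℝ | 0 < t ∧ Module.End.HasEigenvalue (Matrix.toLin' (Kᵀ * K)) t}.Nonempty :=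
    exists_pos_hasEigenvalue_gram hK
  exact (hne.csInf_mem hfin).1

theorem lamMinPos_le_lamMax_gram (hK : K ≠ 0) : lamMinPos (Kᵀ * K) ≤ lamMax (Kᵀ * K) := by
  obtain ⟨t, ht, hE⟩ := exists_pos_hasEigenvalue_gram hK
  have hb : BddBelow {t : ℝ | 0 < t ∧ Module.End.HasEigenvalue (Matrix.toLin' (Kᵀ * K)) t} :=
    ⟨0, fun t ht => ht.1.le⟩
  exact (csInf_le hb ⟨ht, hE⟩).trans
    (le_csSup (Module.End.finite_hasEigenvalue _).bddAbove hE)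

end Spectral

/-! ### One-step Lyapunov analysis in error coordinates -/

section Descent

variable {E F : Type*} [NormedAddCommGroup E] [InnerProductSpace ℝ E]
  [NormedAddCommGroup F] [InnerProductSpace ℝ F] {A : E →ₗ[ℝ] F} {B : F →ₗ[ℝ] E}

theorem sq_norm_adjoint_le (hAB : ∀ x y, inner ℝ (B y) x = inner ℝ y (A x)) {Λ : ℝ}
    (hΛ0 : 0 ≤ Λ) (hΛ : ∀ x, ‖A x‖ ^ 2 ≤ Λ * ‖x‖ ^ 2) (y : F) : ‖B y‖ ^ 2 ≤ Λ * ‖y‖ ^ 2 := by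
  rcases (norm_nonneg (B y)).eq_or_lt with h0 | h0
  · rw [← h0, zero_pow two_ne_zero]
    positivity
  · have h1 : ‖B y‖ ^ 2 ≤ ‖y‖ * ‖A (B y)‖ := by
      rw [← real_inner_self_eq_norm_sq, hAB]
      exact real_inner_le_norm _ _
    have h2 : ‖B y‖ ^ 2 * ‖B y‖ ^ 2 ≤ ‖B y‖ ^ 2 * (Λ * ‖y‖ ^ 2) := by
      calc ‖B y‖ ^ 2 * ‖B y‖ ^ 2 ≤ (‖y‖ * ‖A (B y)‖) * (‖y‖ * ‖A (B y)‖) := by gcongr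
        _ = ‖y‖ ^ 2 * ‖A (B y)‖ ^ 2 := by ring
        _ ≤ ‖y‖ ^ 2 * (Λ * ‖B y‖ ^ 2) := by gcongr; exact hΛ _
        _ = _ := by ring
    exact le_of_mul_le_mul_left h2 (by positivity)

/-- The weighted dual distance in the Lyapunov function. -/
noncomputable def dualForm (B : F →ₗ[ℝ] E) (η θ μ : ℝ) (y : F) : ℝ :=
  1 / θ * ‖y‖ ^ 2 - η / (1 + η * μ) * ‖B y‖ ^ 2

/-- The Lyapunov function of APAPC in terms of the primal error `e`, the dual error `y` and the
Bregman divergence `φ` of the averaged iterate. -/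
noncomputable def apapcLyapunov (B : F →ₗ[ℝ] E) (η θ μ τ δ : ℝ) (e : E) (y : F) (φ : ℝ) : ℝ :=
  (1 + η * μ) * ‖e‖ ^ 2 + η * (dualForm B η θ μ y + δ / θ * ‖y‖ ^ 2)
    + 2 * η * (1 - τ / 2) / τ * φ

/-- The choice of θ makes 1/θ = ηΛ, which dominates η‖By‖². -/
theorem dualForm_nonneg {Λ η θ μ : ℝ} (hB : ∀ y, ‖B y‖ ^ 2 ≤ Λ * ‖y‖ ^ 2) (hη : 0 < η)
    (hμ : 0 < μ) (hθ : θ = 1 / (η * Λ)) (y : F) : 0 ≤ dualForm B η θ μ y := by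
  have h1 : η / (1 + η * μ) ≤ η := div_le_self hη.le (by nlinarith [mul_pos hη hμ])
  have h2 : η / (1 + η * μ) * ‖B y‖ ^ 2 ≤ η * (Λ * ‖y‖ ^ 2) := by
    gcongr
    exact hB y
  have h3 : 1 / θ = η * Λ := by rw [hθ, one_div_one_div]
  rw [dualForm, h3]
  linarith

theorem dualForm_le {η θ μ : ℝ} (hη : 0 < η) (hμ : 0 < μ) (y : F) :
    dualForm B η θ μ y ≤ 1 / θ * ‖y‖ ^ 2 := by
  have : 0 ≤ η / (1 + η * μ) * ‖B y‖ ^ 2 := by positivity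
  rw [dualForm]
  linarith

/-- The corrected point is e' = eh - η/(1+ημ) B(y' - y), and A eh = (y' - y)/θ. Hence ⟪By', e'⟫ is
the bilinear form of `dualForm` at (y', y' - y), and polarization applies. -/
theorem two_mul_inner_dual_update (hAB : ∀ x y, inner ℝ (B y) x = inner ℝ y (A x))
    {η θ μ : ℝ} (hη : 0 < η) (hμ : 0 < μ) (hθ : 0 < θ) {e e' eh γ : E} {y y' : F}
    (hy : y' = y + θ • A eh)
    (heh : (1 + η * μ) • eh = e - η • (γ + B y))
    (he : (1 + η * μ) • e' = e - η • (γ + B y')) :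
    2 * inner ℝ (B y') e' = dualForm B η θ μ y' - dualForm B η θ μ y
      + dualForm B η θ μ (y' - y) := by
  have hpos : 0 < 1 + η * μ := by positivity
  have hee : e' = eh - (η / (1 + η * μ)) • B (y' - y) := by
    have : (1 + η * μ) • e' = (1 + η * μ) • (eh - (η / (1 + η * μ)) • B (y' - y)) := by
      rw [smul_sub, heh, he, smul_smul, mul_div_cancel₀ _ hpos.ne', map_sub]
      module
    exact smul_right_injective _ hpos.ne' this
  have hA : A eh = (1 / θ) • (y' - y) := by
    rw [hy, add_sub_cancel_left, smul_smul, one_div_mul_cancel hθ.ne', one_smul]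
  have h1 : inner ℝ (B y') e' = 1 / θ * inner ℝ y' (y' - y)
      - η / (1 + η * μ) * inner ℝ (B y') (B (y' - y)) := by
    rw [hee, inner_sub_right, hAB, hA, inner_smul_right, inner_smul_right]
  rw [h1]
  simp only [dualForm, map_sub, inner_sub_right, norm_sub_sq_real, real_inner_self_eq_norm_sq]
  ring

/-- The implicit step gives an energy identity for ‖e'‖² whose dual inner product telescopes. The
gradient inner product is absorbed by acceleration: `h1`, `h2`, `h3` are added with weights 2η,
2η(1-τ)/τ and η(2-τ)/τ, so that the terms in γ cancel up to ‖γ‖². -/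
theorem apapc_descent (hAB : ∀ x y, inner ℝ (B y) x = inner ℝ y (A x))
    {L η θ μ τ : ℝ} (hL : 0 < L) (hη : 0 < η) (hμ : 0 < μ) (hθ : 0 < θ) (hτ : 0 < τ)
    (hτ1 : τ ≤ 1) (hLη : 4 * (η * τ * L) ≤ 1)
    (hQ : ∀ y, 0 ≤ dualForm B η θ μ y)
    {e f e' eh γ : E} {y y' : F} {φg φf φ' : ℝ}
    (hy : y' = y + θ • A eh)
    (heh : (1 + η * μ) • eh = e - η • (γ + B y))
    (he : (1 + η * μ) • e' = e - η • (γ + B y'))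
    (hφg : 0 ≤ φg)
    (h1 : φg + 1 / (2 * L) * ‖γ‖ ^ 2 ≤ inner ℝ γ (τ • e + (1 - τ) • f))
    (h2 : φg - φf ≤ inner ℝ γ ((τ • e + (1 - τ) • f) - f))
    (h3 : φ' ≤ φg + inner ℝ γ ((2 * τ / (2 - τ)) • (e' - e))
      + L / 2 * ‖(2 * τ / (2 - τ)) • (e' - e)‖ ^ 2) :
    (1 + 2 * (η * μ)) * ‖e'‖ ^ 2 + η * dualForm B η θ μ y' + 2 * η * (1 - τ / 2) / τ * φ'
      + 1 / 2 * ‖e' - e‖ ^ 2 + η / L * ‖γ‖ ^ 2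
      ≤ ‖e‖ ^ 2 + η * dualForm B η θ μ y + 2 * η * (1 - τ) / τ * φf := by
  have hdual := two_mul_inner_dual_update hAB hη hμ hθ hy heh he
  have hQ' := mul_nonneg hη.le (hQ (y' - y))
  have h2τ : 0 < 2 - τ := by linarith
  have hprim : ‖e'‖ ^ 2 = ‖e‖ ^ 2 - ‖e' - e‖ ^ 2 - 2 * η * inner ℝ γ e'
      - 2 * (η * μ) * ‖e'‖ ^ 2 - 2 * η * inner ℝ (B y') e' := by
    have hd : e' - e = -(η • (γ + B y')) - (η * μ) • e' := by
      rw [add_smul, one_smul] at he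
      linear_combination (norm := module) he
    have hin : inner ℝ (e' - e) e' = -η * inner ℝ γ e' - η * inner ℝ (B y') e'
        - η * μ * ‖e'‖ ^ 2 := by
      rw [hd, inner_sub_left, inner_neg_left, inner_smul_left, inner_smul_left, inner_add_left,
        real_inner_self_eq_norm_sq]
      simp
      ring
    have hexp : ‖e‖ ^ 2 = ‖e'‖ ^ 2 - 2 * inner ℝ (e' - e) e' + ‖e' - e‖ ^ 2 := by
      have := norm_sub_sq_real e' (e' - e)
      rw [sub_sub_cancel, real_inner_comm] at this
      exact this
    linarith
  have hacc : -(2 * η * inner ℝ γ e') + η / L * ‖γ‖ ^ 2 + 2 * η * (1 - τ / 2) / τ * φ'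
      ≤ 1 / 2 * ‖e' - e‖ ^ 2 + 2 * η * (1 - τ) / τ * φf := by
    rw [norm_smul, mul_pow, Real.norm_eq_abs, sq_abs, inner_smul_right, inner_sub_right] at h3
    rw [inner_add_right, inner_smul_right, inner_smul_right] at h1
    rw [inner_sub_right, inner_add_right, inner_smul_right, inner_smul_right] at h2
    set a := inner ℝ γ e
    set a' := inner ℝ γ e'
    set b := inner ℝ γ f
    set n := ‖e' - e‖ ^ 2
    have hn : 0 ≤ n := sq_nonneg _
    set G := ‖γ‖ ^ 2
    have k1 : η / L * G = 2 * η * (1 / (2 * L) * G) := by field_simp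
    have k2 : 2 * η * (1 - τ / 2) / τ * φ' ≤ η * ((2 - τ) / τ) * φg + 2 * η * (a' - a)
        + η * L * (2 * τ / (2 - τ)) * n := by
      have := mul_le_mul_of_nonneg_left h3 (show 0 ≤ η * ((2 - τ) / τ) by positivity)
      have q : η * ((2 - τ) / τ) * (2 * τ / (2 - τ)) = 2 * η := by
        field_simp [h2τ.ne']
      have q' : 2 * η * (1 - τ / 2) / τ = η * ((2 - τ) / τ) := by
        field_simp
      rw [q']
      refine this.trans_eq ?_
      linear_combination (a' - a + L / 2 * (2 * τ / (2 - τ)) * n) * q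
    -- Here 4ητL ≤ 1 and 2 - τ ≥ 1; the other half of ‖e' - e‖² is kept for the dual error.
    have k3 : η * L * (2 * τ / (2 - τ)) * n ≤ 1 / 2 * n := by
      gcongr
      rw [← mul_div_assoc, div_le_iff₀ h2τ]
      nlinarith
    have k4 : 2 * η * (1 - τ) / τ * (φg - φf) ≤ 2 * η * (1 - τ) * (a - b) := by
      have := mul_le_mul_of_nonneg_left h2
        (show 0 ≤ 2 * η * (1 - τ) / τ from
          div_nonneg (mul_nonneg (by positivity) (by linarith)) hτ.le)
      refine this.trans_eq ?_
      field_simp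
      ring
    have k5 : 2 * η * (φg + 1 / (2 * L) * G) ≤ 2 * η * (τ * a + (1 - τ) * b) := by gcongr
    have k6 : η * ((2 - τ) / τ) * φg = 2 * η * (1 - τ) / τ * φg + η * φg := by
      field_simp
      ring
    have k7 := mul_nonneg hη.le hφg
    linarith
  have hdual' := congrArg (η * ·) hdual
  linarith

/-- The surplus in `apapc_descent` pays for the extra term δ/θ‖y'‖²: the update expresses ηBy'
through e' - e, e' and γ, and `hy'` converts ‖By'‖² into ‖y'‖². The factor 3 comes from squaring a
sum of three terms, and 6 from the coefficient 1/2 of ‖e' - e‖². -/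
theorem apapcLyapunov_contraction (hAB : ∀ x y, inner ℝ (B y) x = inner ℝ y (A x))
    {L η θ μ τ δ Λ l : ℝ} (hL : 0 < L) (hη : 0 < η) (hμ : 0 < μ) (hτ : 0 < τ)
    (hτ1 : τ ≤ 1) (hLη : 4 * (η * τ * L) ≤ 1) (hl : 0 < l) (hΛ : 0 < Λ)
    (hB : ∀ y, ‖B y‖ ^ 2 ≤ Λ * ‖y‖ ^ 2) (hθ : θ = 1 / (η * Λ))
    (hδ : 0 < δ) (hδη : δ ≤ η * μ) (hδτ : δ ≤ τ / 2)
    (hδ1 : 6 * (δ * Λ) ≤ l) (hδ2 : 3 * (δ * Λ) * (η * L) ≤ l) (hδ3 : 3 * (δ * Λ) * (η * μ) ≤ l)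
    {e f e' eh γ : E} {y y' : F} {φg φf φ' : ℝ}
    (hy' : l * ‖y'‖ ^ 2 ≤ ‖B y'‖ ^ 2)
    (hy : y' = y + θ • A eh)
    (heh : (1 + η * μ) • eh = e - η • (γ + B y))
    (he : (1 + η * μ) • e' = e - η • (γ + B y'))
    (hφg : 0 ≤ φg) (hφf : 0 ≤ φf)
    (h1 : φg + 1 / (2 * L) * ‖γ‖ ^ 2 ≤ inner ℝ γ (τ • e + (1 - τ) • f))
    (h2 : φg - φf ≤ inner ℝ γ ((τ • e + (1 - τ) • f) - f))
    (h3 : φ' ≤ φg + inner ℝ γ ((2 * τ / (2 - τ)) • (e' - e))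
      + L / 2 * ‖(2 * τ / (2 - τ)) • (e' - e)‖ ^ 2) :
    (1 + δ) * apapcLyapunov B η θ μ τ δ e' y' φ' ≤ apapcLyapunov B η θ μ τ δ e y φf := by
  have hθ0 : 0 < θ := hθ ▸ by positivity
  have hQ := dualForm_nonneg hB hη hμ hθ
  have hdesc := apapc_descent hAB hL hη hμ hθ0 hτ hτ1 hLη hQ hy heh he hφg h1 h2 h3
  have hinv : 1 / θ = η * Λ := by rw [hθ, one_div_one_div]
  have hdual : η * (δ / θ * ‖y'‖ ^ 2)
      ≤ 1 / 2 * ‖e' - e‖ ^ 2 + η * μ * ‖e'‖ ^ 2 + η / L * ‖γ‖ ^ 2 := by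
    have hBy : ‖η • B y'‖ ^ 2 ≤ 3 * (‖e' - e‖ ^ 2 + (η * μ) ^ 2 * ‖e'‖ ^ 2 + η ^ 2 * ‖γ‖ ^ 2) := by
      have hd : η • B y' = -((e' - e) + (η * μ) • e' + η • γ) := by
        rw [add_smul, one_smul, smul_add] at he
        linear_combination (norm := module) he
      have h4 : ‖η • B y'‖ ≤ ‖e' - e‖ + η * μ * ‖e'‖ + η * ‖γ‖ := by
        rw [hd, norm_neg]
        refine (norm_add₃_le).trans_eq ?_
        rw [norm_smul, norm_smul, Real.norm_of_nonneg hη.le, Real.norm_of_nonneg (by positivity)]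
      refine (pow_le_pow_left₀ (norm_nonneg _) h4 2).trans ?_
      nlinarith [sq_nonneg (‖e' - e‖ - η * μ * ‖e'‖), sq_nonneg (‖e' - e‖ - η * ‖γ‖),
        sq_nonneg (η * μ * ‖e'‖ - η * ‖γ‖)]
    rw [norm_smul, mul_pow, Real.norm_eq_abs, sq_abs] at hBy
    have hδΛ : 0 ≤ δ * Λ := by positivity
    have hmul : l * (η * (δ / θ * ‖y'‖ ^ 2))
        ≤ l * (1 / 2 * ‖e' - e‖ ^ 2 + η * μ * ‖e'‖ ^ 2 + η / L * ‖γ‖ ^ 2) := by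
      have e1 : l * (η * (δ / θ * ‖y'‖ ^ 2)) = δ * Λ * (η ^ 2 * (l * ‖y'‖ ^ 2)) := by
        rw [div_eq_mul_one_div δ θ, hinv]; ring
      have i1 : δ * Λ * (η ^ 2 * (l * ‖y'‖ ^ 2)) ≤ δ * Λ * (η ^ 2 * ‖B y'‖ ^ 2) := by gcongr
      have i2 := mul_le_mul_of_nonneg_left hBy hδΛ
      have i3 := mul_le_mul_of_nonneg_right hδ1 (sq_nonneg ‖e' - e‖)
      have i4 := mul_le_mul_of_nonneg_right hδ2 (show 0 ≤ η / L * ‖γ‖ ^ 2 by positivity)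
      have i5 := mul_le_mul_of_nonneg_right hδ3 (show 0 ≤ η * μ * ‖e'‖ ^ 2 by positivity)
      have e2 : 3 * (δ * Λ) * (η * L) * (η / L * ‖γ‖ ^ 2) = 3 * (δ * Λ) * (η ^ 2 * ‖γ‖ ^ 2) := by
        field_simp
      rw [e2] at i4
      linarith
    exact le_of_mul_le_mul_left hmul hl
  -- `V' ≤ ‖e‖² + η Q(y) + 2η(1-τ)/τ φ`, and each term is a contraction of one in `V`
  have hmain : apapcLyapunov B η θ μ τ δ e' y' φ'
      ≤ ‖e‖ ^ 2 + η * dualForm B η θ μ y + 2 * η * (1 - τ) / τ * φf := by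
    rw [apapcLyapunov]
    linarith
  refine (mul_le_mul_of_nonneg_left hmain (by positivity)).trans ?_
  have j1 : (1 + δ) * ‖e‖ ^ 2 ≤ (1 + η * μ) * ‖e‖ ^ 2 := by gcongr
  have j2 : η * (δ * dualForm B η θ μ y) ≤ η * (δ / θ * ‖y‖ ^ 2) := by
    rw [div_eq_mul_one_div, mul_assoc]
    gcongr
    exact dualForm_le hη hμ y
  have j3 : (1 + δ) * (2 * η * (1 - τ) / τ * φf) ≤ 2 * η * (1 - τ / 2) / τ * φf := by
    have : (1 + δ) * (1 - τ) ≤ 1 - τ / 2 := by nlinarith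
    have := mul_le_mul_of_nonneg_left this (show 0 ≤ 2 * η / τ * φf by positivity)
    calc (1 + δ) * (2 * η * (1 - τ) / τ * φf) = 2 * η / τ * φf * ((1 + δ) * (1 - τ)) := by ring
      _ ≤ _ := this
      _ = _ := by ring
  rw [apapcLyapunov]
  linarith

end Descent

/-! ### Existence, uniqueness and optimality for the regularized problem -/

section Minimizer

variable {p d : ℕ} {K : Matrix (Fin p) (Fin d) ℝ} {c : EuclideanSpace ℝ (Fin p)}
  {h : EuclideanSpace ℝ (Fin d) → ℝ} {L μ : ℝ}

theorem exists_isAffineSolution_regularized (hμ : 0 < μ)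
    (hc : c ∈ LinearMap.range (Matrix.toEuclideanLin K)) (hcv : ConvexOn ℝ Set.univ h)
    (hs : IsLSmooth L h) : ∃ u, IsAffineSolution (regularized h μ) K c u := by
  obtain ⟨v, hv⟩ := hc
  have hcont : Continuous (regularized h μ) := by
    have := hs.1.continuous
    unfold regularized
    fun_prop
  have hclosed : IsClosed {u | Matrix.toEuclideanLin K u = c} :=
    isClosed_eq (Matrix.toEuclideanLin K).continuous_of_finiteDimensional continuous_const
  obtain ⟨u, hu, hmin⟩ := hcont.continuousOn.exists_isMinOn' hclosed hv (by
    refine Filter.Eventually.filter_mono inf_le_left ?_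
    set g := ‖gradient h 0‖
    set a := |regularized h μ v - h 0|
    -- By the tangent at 0, the objective exceeds h 0 by at least ‖x‖(μ‖x‖/2 - g). Outside this
    -- radius that is at least a.
    filter_upwards [(tendsto_norm_cocompact_atTop
      (E := EuclideanSpace ℝ (Fin d))).eventually_ge_atTop (1 + 2 * (g + a) / μ)] with x hx
    have h1 := hcv.add_inner_gradient_le hs.1 0 x
    rw [sub_zero] at h1
    have h2 := neg_le_of_abs_le (abs_real_inner_le_norm (gradient h 0) x)
    have h3 : regularized h μ v - h 0 ≤ a := le_abs_self _
    have ha : 0 ≤ a := abs_nonneg _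
    have hg : 0 ≤ g := norm_nonneg _
    have hx1 : 1 ≤ ‖x‖ := le_trans (by simp; positivity) hx
    have hx2 : g + a ≤ μ * ‖x‖ / 2 := by
      have : 2 * (g + a) / μ ≤ ‖x‖ := by linarith
      rw [div_le_iff₀ hμ] at this
      linarith
    have h4 : a ≤ ‖x‖ * (μ * ‖x‖ / 2 - g) := by nlinarith
    unfold regularized at h3 ⊢
    nlinarith)
  exact ⟨u, hu, fun w hw => hmin hw⟩

theorem IsAffineSolution.inner_gradient_add_eq_zero {u w : EuclideanSpace ℝ (Fin d)}
    (hL : 0 < L) (hμ : 0 < μ) (hs : IsLSmooth L h)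
    (hu : IsAffineSolution (regularized h μ) K c u) (hw : Matrix.toEuclideanLin K w = 0) :
    inner ℝ (gradient h u + μ • u) w = 0 := by
  set a := inner ℝ (gradient h u + μ • u) w with ha
  have key : ∀ t : ℝ, 0 ≤ t * a + (L + μ) / 2 * ‖w‖ ^ 2 * t ^ 2 := fun t => by
    have h1 := hu.2 (u + t • w) (by rw [map_add, map_smul, hw, smul_zero, add_zero, hu.1])
    have h2 := hs.2 u (u + t • w)
    rw [add_sub_cancel_left, inner_smul_right, norm_smul, mul_pow, Real.norm_eq_abs,
      sq_abs] at h2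
    have h3 := norm_add_sq_real u (t • w)
    rw [inner_smul_right, norm_smul, mul_pow, Real.norm_eq_abs, sq_abs] at h3
    have h4 : a = inner ℝ (gradient h u) w + μ * inner ℝ u w := by
      rw [ha, inner_add_left, inner_smul_left]; rfl
    unfold regularized at h1
    rw [h3] at h1
    rw [h4]
    linarith
  set b := (L + μ) / 2 * ‖w‖ ^ 2
  have hb : 0 ≤ b := by positivity
  by_contra hne
  -- A near-minimizer of ta + bt²; the added 1 covers b = 0.
  have := key (-a / (b + 1))
  have h5 : -a / (b + 1) * a + b * (-a / (b + 1)) ^ 2 = -(a ^ 2 / (b + 1) ^ 2) := by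
    field_simp
    ring
  have h6 : 0 < a ^ 2 / (b + 1) ^ 2 := by positivity
  linarith

theorem IsAffineSolution.eq_of_regularized {u v : EuclideanSpace ℝ (Fin d)} (hL : 0 < L)
    (hμ : 0 < μ) (hcv : ConvexOn ℝ Set.univ h) (hs : IsLSmooth L h)
    (hu : IsAffineSolution (regularized h μ) K c u)
    (hv : IsAffineSolution (regularized h μ) K c v) : v = u := by
  have h1 := hu.inner_gradient_add_eq_zero hL hμ hs (w := v - u)
    (by rw [map_sub, hv.1, hu.1, sub_self])
  have h2 := hcv.add_inner_gradient_le hs.1 u v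
  have h3 := hv.2 u hu.1
  have h4 := norm_add_sq_real u (v - u)
  rw [add_sub_cancel] at h4
  rw [inner_add_left, inner_smul_left] at h1
  simp only [conj_trivial] at h1
  unfold regularized at h3
  rw [h4] at h3
  have h5 : ‖v - u‖ ^ 2 ≤ 0 := by
    have : μ * ‖v - u‖ ^ 2 ≤ μ * 0 := by linarith
    exact le_of_mul_le_mul_left this hμ
  have h6 : ‖v - u‖ = 0 := by nlinarith [norm_nonneg (v - u)]
  exact sub_eq_zero.1 (norm_eq_zero.1 h6)

/-- The gradient is orthogonal to ker K, which contains the orthogonal complement of Im KᵀK. Using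
Im KᵀK instead of Im Kᵀ places the multiplier in Im K. -/
theorem IsAffineSolution.exists_multiplier {u : EuclideanSpace ℝ (Fin d)}
    (hL : 0 < L) (hμ : 0 < μ) (hs : IsLSmooth L h)
    (hu : IsAffineSolution (regularized h μ) K c u) :
    ∃ y ∈ LinearMap.range (Matrix.toEuclideanLin K),
      gradient h u + μ • u + Matrix.toEuclideanLin Kᵀ y = 0 := by
  have hmem : -(gradient h u + μ • u) ∈
      LinearMap.range (Matrix.toEuclideanLin Kᵀ ∘ₗ Matrix.toEuclideanLin K) := by
    rw [← Submodule.orthogonal_orthogonal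
      (LinearMap.range (Matrix.toEuclideanLin Kᵀ ∘ₗ Matrix.toEuclideanLin K)),
      Submodule.mem_orthogonal']
    intro w hw
    have hw0 : Matrix.toEuclideanLin K w = 0 := by
      have := (Submodule.mem_orthogonal _ _).1 hw _ (LinearMap.mem_range_self _ w)
      rw [LinearMap.comp_apply, inner_toEuclideanLin_transpose] at this
      exact inner_self_eq_zero.1 this
    rw [inner_neg_left, hu.inner_gradient_add_eq_zero hL hμ hs hw0, neg_zero]
  obtain ⟨q, hq⟩ := hmem
  refine ⟨_, LinearMap.mem_range_self _ q, ?_⟩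
  rw [LinearMap.comp_apply] at hq
  rw [hq, add_neg_cancel]

/-- The regularized solutions grow at most like `1 / μ`. -/
theorem IsAffineSolution.norm_sub_le_div {u v : EuclideanSpace ℝ (Fin d)} (hμ : 0 < μ)
    (hμ1 : μ ≤ 1) (hcv : ConvexOn ℝ Set.univ h) (hs : IsLSmooth L h)
    (hu : IsAffineSolution (regularized h μ) K c u) (hv : Matrix.toEuclideanLin K v = c) :
    ‖u - v‖ ≤ 2 * (‖gradient h v‖ + ‖v‖) / μ := by
  have h1 := hcv.add_inner_gradient_le hs.1 v u
  have h2 := hu.2 v hv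
  have h3 := norm_add_sq_real v (u - v)
  rw [add_sub_cancel] at h3
  have h4 := neg_le_of_abs_le (abs_real_inner_le_norm (gradient h v) (u - v))
  have h5 := neg_le_of_abs_le (abs_real_inner_le_norm v (u - v))
  unfold regularized at h2
  rw [h3] at h2
  set a := ‖u - v‖
  have ha : 0 ≤ a := norm_nonneg _
  have h5' := mul_le_mul_of_nonneg_left h5 hμ.le
  have h6 : a * (a * μ) ≤ a * (2 * (‖gradient h v‖ + ‖v‖)) := by
    have : μ * (‖v‖ * a) ≤ 1 * (‖v‖ * a) := by gcongr
    linarith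
  rw [le_div_iff₀ hμ]
  rcases ha.eq_or_lt with h0 | h0
  · rw [← h0, zero_mul]; positivity
  · exact le_of_mul_le_mul_left h6 h0

end Minimizer

/-! ### From the algorithm to the Lyapunov recursion -/

section Iteration

variable {p d : ℕ} {K : Matrix (Fin p) (Fin d) ℝ} {c : EuclideanSpace ℝ (Fin p)}
  {h : EuclideanSpace ℝ (Fin d) → ℝ} {L η θ μ τ δ : ℝ}

/-- The Bregman divergence of `h`. -/
noncomputable def bregman (h : EuclideanSpace ℝ (Fin d) → ℝ) (x u : EuclideanSpace ℝ (Fin d)) : ℝ :=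
  h x - h u - inner ℝ (gradient h u) (x - u)

theorem bregman_nonneg (hcv : ConvexOn ℝ Set.univ h) (hd : Differentiable ℝ h)
    (x u : EuclideanSpace ℝ (Fin d)) : 0 ≤ bregman h x u := by
  have := hcv.add_inner_gradient_le hd u x
  rw [bregman]
  linarith

/-- The dual variable y is implicit in the method: z = Kᵀy and y moves by θ(Ku^{k+1/2} - c). Since c
= Kx, the difference y - ys stays in Im K. -/
theorem apapcStep_contraction (hL : 0 < L) (hη : 0 < η) (hμ : 0 < μ) (hτ : 0 < τ)
    (hτ1 : τ ≤ 1) (hLη : 4 * (η * τ * L) ≤ 1) (hK : K ≠ 0)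
    (hθ : θ = 1 / (η * lamMax (Kᵀ * K)))
    (hδ : 0 < δ) (hδη : δ ≤ η * μ) (hδτ : δ ≤ τ / 2)
    (hδ1 : 6 * (δ * lamMax (Kᵀ * K)) ≤ lamMinPos (Kᵀ * K))
    (hδ2 : 3 * (δ * lamMax (Kᵀ * K)) * (η * L) ≤ lamMinPos (Kᵀ * K))
    (hδ3 : 3 * (δ * lamMax (Kᵀ * K)) * (η * μ) ≤ lamMinPos (Kᵀ * K))
    (hcv : ConvexOn ℝ Set.univ h) (hs : IsLSmooth L h)
    {x : EuclideanSpace ℝ (Fin d)} (hx : Matrix.toEuclideanLin K x = c)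
    {ys : EuclideanSpace ℝ (Fin p)}
    (hys : gradient h x + μ • x + Matrix.toEuclideanLin Kᵀ ys = 0)
    (s : APAPCState d) {y : EuclideanSpace ℝ (Fin p)} (hz : s.z = Matrix.toEuclideanLin Kᵀ y)
    (hy : y - ys ∈ LinearMap.range (Matrix.toEuclideanLin K)) :
    ∃ y', (apapcStep (regularized h μ) K c η θ μ τ s).z = Matrix.toEuclideanLin Kᵀ y' ∧
      y' - ys ∈ LinearMap.range (Matrix.toEuclideanLin K) ∧
      (1 + δ) * apapcLyapunov (Matrix.toEuclideanLin Kᵀ) η θ μ τ δ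
          ((apapcStep (regularized h μ) K c η θ μ τ s).u - x) (y' - ys)
          (bregman h (apapcStep (regularized h μ) K c η θ μ τ s).uf x)
        ≤ apapcLyapunov (Matrix.toEuclideanLin Kᵀ) η θ μ τ δ (s.u - x) (y - ys)
          (bregman h s.uf x) := by
  have hl := lamMinPos_gram_pos hK
  have hΛ := hl.trans_le (lamMinPos_le_lamMax_gram hK)
  have hpos : (1 + η * μ) ≠ 0 := by positivity
  set A := Matrix.toEuclideanLin K with hA
  set B := Matrix.toEuclideanLin Kᵀ with hBdef
  obtain ⟨u, uf, z⟩ := s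
  simp only at hz
  subst hz
  set ug := τ • u + (1 - τ) • uf with hug
  set uh := (1 + η * μ)⁻¹ • (u - η • (gradient h ug + B y)) with huh
  set y' := y + θ • (A uh - c) with hy'
  set u' := (1 + η * μ)⁻¹ • (u - η • (gradient h ug + B y')) with hu'
  have hgrad : gradient (regularized h μ) ug - μ • ug = gradient h ug := by
    rw [gradient_regularized hs.1, add_sub_cancel_right]
  have hstep : apapcStep (regularized h μ) K c η θ μ τ ⟨u, uf, B y⟩
      = ⟨u', ug + (2 * τ / (2 - τ)) • (u' - u), B y'⟩ := by
    simp only [apapcStep, ← hug, hgrad, ← hA, ← hBdef, ← huh, hu', hy', map_add, map_smul]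
  have hmem : y' - ys ∈ LinearMap.range A := by
    obtain ⟨q, hq⟩ := hy
    refine ⟨q + θ • (uh - x), ?_⟩
    rw [map_add, hq, map_smul, map_sub, hx, hy']
    abel
  refine ⟨y', by rw [hstep], hmem, ?_⟩
  rw [hstep]
  -- Subtracting the optimality condition `hys` removes x and ys from the update.
  have hxe : ∀ w : EuclideanSpace ℝ (Fin p), ∀ v,
      v = (1 + η * μ)⁻¹ • (u - η • (gradient h ug + B w)) →
      (1 + η * μ) • (v - x)
        = (u - x) - η • ((gradient h ug - gradient h x) + B (w - ys)) := by
    rintro w v rfl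
    rw [smul_sub, smul_inv_smul₀ hpos, map_sub]
    linear_combination (norm := module) (-η) • hys
  refine apapcLyapunov_contraction (A := A) (L := L) (f := uf - x) (eh := uh - x)
    (γ := gradient h ug - gradient h x) (φg := bregman h ug x)
    (fun a b => inner_toEuclideanLin_transpose K a b) hL hη hμ hτ hτ1 hLη hl hΛ
    (sq_norm_adjoint_le (fun a b => inner_toEuclideanLin_transpose K a b) hΛ.le
      (sq_norm_toEuclideanLin_le K)) hθ hδ hδη hδτ hδ1 hδ2 hδ3 ?_ ?_ (hxe y uh huh) (hxe y' u' hu')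
      (bregman_nonneg hcv hs.1 _ _) (bregman_nonneg hcv hs.1 _ _) ?_ ?_ ?_
  · obtain ⟨q, hq⟩ := hmem
    rw [← hq]
    exact lamMinPos_mul_sq_norm_le K q
  · rw [map_sub, hx, hy']
    abel
  · have h1 := hcv.add_sq_norm_gradient_sub_le hL hs.1 hs.2 ug x
    rw [norm_sub_rev, ← neg_sub ug x, inner_neg_right] at h1
    rw [show τ • (u - x) + (1 - τ) • (uf - x) = ug - x by rw [hug]; module, bregman,
      inner_sub_left]
    linarith
  · have h1 := hcv.add_inner_gradient_le hs.1 ug uf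
    rw [show τ • (u - x) + (1 - τ) • (uf - x) - (uf - x) = ug - uf by rw [hug]; module]
    simp only [bregman, inner_sub_left, inner_sub_right] at h1 ⊢
    linarith
  · have h1 := hs.2 ug (ug + (2 * τ / (2 - τ)) • (u' - u))
    rw [add_sub_cancel_left] at h1
    rw [sub_sub_sub_cancel_right]
    simp only [bregman, inner_sub_left, inner_sub_right, inner_add_right] at h1 ⊢
    linarith

theorem apapcState_bound (hL : 0 < L) (hη : 0 < η) (hμ : 0 < μ) (hτ : 0 < τ)
    (hτ1 : τ ≤ 1) (hLη : 4 * (η * τ * L) ≤ 1) (hK : K ≠ 0)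
    (hθ : θ = 1 / (η * lamMax (Kᵀ * K)))
    (hδ : 0 < δ) (hδη : δ ≤ η * μ) (hδτ : δ ≤ τ / 2)
    (hδ1 : 6 * (δ * lamMax (Kᵀ * K)) ≤ lamMinPos (Kᵀ * K))
    (hδ2 : 3 * (δ * lamMax (Kᵀ * K)) * (η * L) ≤ lamMinPos (Kᵀ * K))
    (hδ3 : 3 * (δ * lamMax (Kᵀ * K)) * (η * μ) ≤ lamMinPos (Kᵀ * K))
    (hcv : ConvexOn ℝ Set.univ h) (hs : IsLSmooth L h)
    {x : EuclideanSpace ℝ (Fin d)} (hx : Matrix.toEuclideanLin K x = c)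
    {ys : EuclideanSpace ℝ (Fin p)}
    (hys : gradient h x + μ • x + Matrix.toEuclideanLin Kᵀ ys = 0)
    (hysr : ys ∈ LinearMap.range (Matrix.toEuclideanLin K))
    (u0 : EuclideanSpace ℝ (Fin d)) (N : ℕ) :
    (1 + δ) ^ N * ‖(apapcState (regularized h μ) K c η θ μ τ u0 N).u - x‖ ^ 2 ≤
      apapcLyapunov (Matrix.toEuclideanLin Kᵀ) η θ μ τ δ (u0 - x) (-ys) (bregman h u0 x) := by
  have key : ∃ y, (apapcState (regularized h μ) K c η θ μ τ u0 N).z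
        = Matrix.toEuclideanLin Kᵀ y ∧
      y - ys ∈ LinearMap.range (Matrix.toEuclideanLin K) ∧
      (1 + δ) ^ N * apapcLyapunov (Matrix.toEuclideanLin Kᵀ) η θ μ τ δ
          ((apapcState (regularized h μ) K c η θ μ τ u0 N).u - x) (y - ys)
          (bregman h (apapcState (regularized h μ) K c η θ μ τ u0 N).uf x)
        ≤ apapcLyapunov (Matrix.toEuclideanLin Kᵀ) η θ μ τ δ (u0 - x) (-ys)
          (bregman h u0 x) := by
    induction N with
    | zero =>
      -- As z⁰ = 0, the dual iteration starts at y = 0, with error -ys.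
      refine ⟨0, by simp [apapcState], ?_, by simp [apapcState]⟩
      rw [zero_sub]
      exact neg_mem hysr
    | succ n ih =>
      obtain ⟨y, h1, h2, h3⟩ := ih
      obtain ⟨y', h4, h5, h6⟩ := apapcStep_contraction hL hη hμ hτ hτ1 hLη hK hθ hδ hδη hδτ hδ1
        hδ2 hδ3 hcv hs hx hys _ h1 h2
      have hsucc : apapcState (regularized h μ) K c η θ μ τ u0 (n + 1)
          = apapcStep (regularized h μ) K c η θ μ τ
            (apapcState (regularized h μ) K c η θ μ τ u0 n) :=
        Function.iterate_succ_apply' _ _ _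
      rw [hsucc]
      refine ⟨y', h4, h5, le_trans ?_ h3⟩
      rw [pow_succ, mul_assoc]
      gcongr
  obtain ⟨y, -, -, hV⟩ := key
  refine le_trans ?_ hV
  have hΛ := (lamMinPos_gram_pos hK).trans_le (lamMinPos_le_lamMax_gram hK)
  have hQ := dualForm_nonneg (sq_norm_adjoint_le
    (fun a b => inner_toEuclideanLin_transpose K a b) hΛ.le (sq_norm_toEuclideanLin_le K))
    hη hμ hθ (y - ys)
  have hB := bregman_nonneg hcv hs.1 (apapcState (regularized h μ) K c η θ μ τ u0 N).uf x
  have hθ0 : 0 < θ := hθ ▸ by positivity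
  have h1 : 0 ≤ η * (dualForm (Matrix.toEuclideanLin Kᵀ) η θ μ (y - ys)
      + δ / θ * ‖y - ys‖ ^ 2) := by positivity
  have h2 : 0 ≤ 2 * η * (1 - τ / 2) / τ *
      bregman h (apapcState (regularized h μ) K c η θ μ τ u0 N).uf x :=
    mul_nonneg (div_nonneg (mul_nonneg (by positivity) (by linarith)) hτ.le) hB
  have h3 : 0 ≤ η * μ * ‖(apapcState (regularized h μ) K c η θ μ τ u0 N).u - x‖ ^ 2 := by
    positivity
  gcongr
  rw [apapcLyapunov]
  linarith

end Iteration

/-! ### Parameters and linear rate -/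

theorem one_le_condNumber {p d : ℕ} {K : Matrix (Fin p) (Fin d) ℝ} (hK : K ≠ 0) :
    1 ≤ condNumber K :=
  (one_le_div (lamMinPos_gram_pos hK)).2 (lamMinPos_le_lamMax_gram hK)

section Rate

variable {p d : ℕ} {K : Matrix (Fin p) (Fin d) ℝ} {c : EuclideanSpace ℝ (Fin p)}
  {h : EuclideanSpace ℝ (Fin d) → ℝ} {L μ : ℝ}

/-- Here r = √(κ_K κ_P), and κ_K ≤ r means κ_K ≤ κ_P, so the minimum is the square-root term. -/
theorem apapcTau_eq {LP μP r : ℝ} (hκ1 : 1 ≤ condNumber K) (hLP : 0 < LP) (hμP : 0 < μP)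
    (hr : 0 < r) (hr2 : r ^ 2 = condNumber K * (LP / μP)) (hκr : condNumber K ≤ r) :
    apapcTau K LP μP = condNumber K / (2 * r) := by
  have hκ : 0 < condNumber K := by linarith
  have hP : 0 < LP / μP := by positivity
  have h1 : condNumber K / (LP / μP) = (condNumber K / r) ^ 2 := by
    rw [div_pow, hr2]
    field_simp
  have h2 : condNumber K / r ≤ 1 := (div_le_one hr).2 hκr
  rw [apapcTau, h1, Real.sqrt_sq (by positivity), min_eq_right (by linarith)]
  field_simp

/-- A coarse bound suffices, since powers of 1/μ only affect the constant in front of the logarithm.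
-/
theorem apapcLyapunov_initial_le {E F : Type*} [NormedAddCommGroup E] [InnerProductSpace ℝ E]
    [NormedAddCommGroup F] [InnerProductSpace ℝ F] {B : F →ₗ[ℝ] E}
    {L η θ μ τ δ Λ l k φ G : ℝ} (hL : 0 < L) (hη : 0 < η) (hμ : 0 < μ) (hτ : 0 < τ) (hl : 0 < l)
    (hkl : Λ = k * l) (hΛ : 0 < Λ) (hθ : θ = 1 / (η * Λ))
    (hδ1 : δ ≤ 1) (hημ : η * μ ≤ 1) (hηk : η ^ 2 * k ≤ 1 / (4 * (μ * L)))
    (hητ : η / τ ≤ 1 / μ) {e : E} {y : F} (hy : l * ‖y‖ ^ 2 ≤ G ^ 2) (hφ0 : 0 ≤ φ)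
    (hφ : φ ≤ L / 2 * ‖e‖ ^ 2) :
    apapcLyapunov B η θ μ τ δ e y φ ≤
      2 * ‖e‖ ^ 2 + G ^ 2 / (μ * L) + L / μ * ‖e‖ ^ 2 := by
  have hθ0 : 0 < θ := hθ ▸ by positivity
  have b1 : (1 + η * μ) * ‖e‖ ^ 2 ≤ 2 * ‖e‖ ^ 2 := by
    gcongr
    linarith
  have b2 : η * (dualForm B η θ μ y + δ / θ * ‖y‖ ^ 2) ≤ G ^ 2 / (μ * L) := by
    have h1 := dualForm_le (B := B) (θ := θ) hη hμ y
    have hinv : 1 / θ = η * Λ := by rw [hθ, one_div_one_div]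
    have h2 : δ / θ * ‖y‖ ^ 2 ≤ 1 / θ * ‖y‖ ^ 2 := by gcongr
    rw [hinv] at h1 h2
    calc _ ≤ η * (2 * (η * Λ * ‖y‖ ^ 2)) := mul_le_mul_of_nonneg_left (by linarith) hη.le
      _ = 2 * (η ^ 2 * k) * (l * ‖y‖ ^ 2) := by rw [hkl]; ring
      _ ≤ 2 * (1 / (4 * (μ * L))) * G ^ 2 := by gcongr
      _ = 1 / 2 * (G ^ 2 / (μ * L)) := by field_simp; norm_num
      _ ≤ _ := by
        have : 0 ≤ G ^ 2 / (μ * L) := by positivity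
        linarith
  have b3 : 2 * η * (1 - τ / 2) / τ * φ ≤ L / μ * ‖e‖ ^ 2 := by
    have h2 : 2 * η * (1 - τ / 2) / τ ≤ 2 / μ := by
      calc 2 * η * (1 - τ / 2) / τ = 2 * (η / τ) * (1 - τ / 2) := by ring
        _ ≤ 2 * (η / τ) * 1 := by gcongr; linarith
        _ ≤ 2 * (1 / μ) := by linarith
        _ = _ := by ring
    calc _ ≤ 2 / μ * (L / 2 * ‖e‖ ^ 2) := mul_le_mul h2 hφ hφ0 (by positivity)
      _ = _ := by field_simp
  rw [apapcLyapunov]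
  linarith

set_option maxHeartbeats 400000 in
/-- Linear convergence of APAPC in the regime `κ_K ≤ κ_P`. -/
theorem apapcIterate_linear_convergence (hK : K ≠ 0) (hL : 0 < L) (hμ : 0 < μ) (hμL : μ ≤ L)
    (hcv : ConvexOn ℝ Set.univ h) (hs : IsLSmooth L h)
    {x : EuclideanSpace ℝ (Fin d)} (hx : IsAffineSolution (regularized h μ) K c x)
    {r : ℝ} (hr : 0 < r) (hr2 : r ^ 2 = condNumber K * ((L + μ) / μ)) (hκr : condNumber K ≤ r)
    (u0 : EuclideanSpace ℝ (Fin d)) (N : ℕ) :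
    (1 + 1 / (6 * r)) ^ N * ‖apapcIterate (regularized h μ) K c (L + μ) μ u0 N - x‖ ^ 2 ≤
      2 * ‖u0 - x‖ ^ 2 + ‖gradient h x + μ • x‖ ^ 2 / (μ * L) + L / μ * ‖u0 - x‖ ^ 2 := by
  have hl := lamMinPos_gram_pos hK
  have hΛ := hl.trans_le (lamMinPos_le_lamMax_gram hK)
  have hκ1 := one_le_condNumber hK
  have hτ := apapcTau_eq hκ1 (by positivity) hμ hr hr2 hκr
  set k := condNumber K with hk
  have hk0 : 0 < k := by linarith
  have hkl : lamMax (Kᵀ * K) = k * lamMinPos (Kᵀ * K) := by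
    rw [hk, condNumber, div_mul_cancel₀ _ hl.ne']
  have hη : apapcEta K (L + μ) μ = r / (2 * k * (L + μ)) := by
    rw [apapcEta, hτ]
    field_simp
    norm_num
  have hθ : apapcTheta K (L + μ) μ = 1 / (apapcEta K (L + μ) μ * lamMax (Kᵀ * K)) := rfl
  obtain ⟨ys, hysr, hys⟩ := hx.exists_multiplier hL hμ hs
  set τ := apapcTau K (L + μ) μ with hτd
  set η := apapcEta K (L + μ) μ with hηd
  set θ := apapcTheta K (L + μ) μ with hθd
  -- The rate is limited by ημ = 1/(2r), τ/2 = κ_K/(4r) and the dual condition 6δκ_K ≤ 1; the last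
  -- is tight when κ_K = r.
  set δ := 1 / (6 * r) with hδ
  have hr1 : 1 ≤ r := hκ1.trans hκr
  have hη0 : 0 < η := by rw [hη]; positivity
  have hτ0 : 0 < τ := by rw [hτ]; positivity
  have hδ0 : 0 < δ := by positivity
  have hηL : η * (L + μ) = r / (2 * k) := by rw [hη]; field_simp
  have hημ : η * μ = 1 / (2 * r) := by
    have h1 : r ^ 2 * μ = k * (L + μ) := by rw [hr2]; field_simp
    rw [hη]
    field_simp
    linarith
  have hδΛ : δ * lamMax (Kᵀ * K) = k / (6 * r) * lamMinPos (Kᵀ * K) := by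
    rw [hδ, hkl]; ring
  have hkr : k / r ≤ 1 := (div_le_one hr).2 hκr
  have hδκ : k / (6 * r) ≤ 1 / 6 := by
    rw [div_le_div_iff₀ (by positivity) (by norm_num)]; linarith
  have hτ1 : τ ≤ 1 := by
    rw [hτ, div_le_one (by positivity)]; linarith
  have hηL' : η * L ≤ r / (2 * k) := by
    rw [← hηL]; gcongr; linarith
  have hδ1 : 6 * (δ * lamMax (Kᵀ * K)) ≤ lamMinPos (Kᵀ * K) := by
    have := mul_le_mul_of_nonneg_right hδκ hl.le
    linarith
  have hδ2' : 3 * (δ * lamMax (Kᵀ * K)) * (r / (2 * k)) ≤ lamMinPos (Kᵀ * K) := by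
    have : 3 * (δ * lamMax (Kᵀ * K)) * (r / (2 * k)) = lamMinPos (Kᵀ * K) / 4 := by
      rw [hδΛ]; field_simp; norm_num
    linarith
  have hδΛ0 : 0 ≤ 3 * (δ * lamMax (Kᵀ * K)) := by positivity
  have hδ2 : 3 * (δ * lamMax (Kᵀ * K)) * (η * L) ≤ lamMinPos (Kᵀ * K) :=
    (mul_le_mul_of_nonneg_left hηL' hδΛ0).trans hδ2'
  have hδ3 : 3 * (δ * lamMax (Kᵀ * K)) * (η * μ) ≤ lamMinPos (Kᵀ * K) :=
    (mul_le_mul_of_nonneg_left (by gcongr) hδΛ0).trans hδ2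
  have hLη : 4 * (η * τ * L) ≤ 1 := by
    have h1 : 4 * (η * τ * L) ≤ 4 * (r / (2 * k) * τ) := by
      have := mul_le_mul_of_nonneg_right hηL' hτ0.le
      linarith
    have h2 : 4 * (r / (2 * k) * τ) = 1 := by
      rw [hτ]; field_simp; norm_num
    linarith
  have hδη : δ ≤ η * μ := by
    rw [hημ, hδ]; gcongr; norm_num
  have hδτ : δ ≤ τ / 2 := by
    rw [hτ, hδ, div_div, div_le_div_iff₀ (by positivity) (by positivity)]
    have := mul_le_mul_of_nonneg_right hκ1 hr.le
    linarith
  refine (apapcState_bound hL hη0 hμ hτ0 hτ1 hLη hK hθ hδ0 hδη hδτ hδ1 hδ2 hδ3 hcv hs hx.1 hys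
    hysr u0 N).trans ?_
  have h1 : r ^ 2 * μ = k * (L + μ) := by rw [hr2]; field_simp
  refine apapcLyapunov_initial_le hL hη0 hμ hτ0 hl hkl hΛ hθ (by linarith)
    (by rw [hημ, div_le_one (by positivity)]; linarith) ?_ ?_ ?_ (bregman_nonneg hcv hs.1 _ _) ?_
  · have h5 : η ^ 2 * k = 1 / (4 * (μ * (L + μ))) := by
      rw [hη, div_pow, hr2]; field_simp; norm_num
    rw [h5]
    gcongr
    linarith
  · have h3 : η / τ = 1 / (k * μ) := by
      rw [hη, hτ]
      field_simp
      linarith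
    rw [h3]
    gcongr
    exact le_mul_of_one_le_left hμ.le hκ1
  · rw [eq_neg_of_add_eq_zero_left hys, norm_neg, norm_neg]
    obtain ⟨q, rfl⟩ := hysr
    exact lamMinPos_mul_sq_norm_le K q
  · have := hs.2 x u0
    rw [bregman]
    linarith

/-- From exp(δ/2) ≤ 1 + δ the power is at least exp(N/(12r)). The constant is 180 = 10 · 12 · 3/2.
-/
theorem inv_pow_le_one_add_pow {ε r s : ℝ} (hε : 0 < ε) (hε1 : ε < 1) (hr : 1 ≤ r)
    (hrs : r ≤ 3 / 2 * s) {N : ℕ} (hN : 180 * s * Real.log (1 / ε) ≤ N) :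
    (1 / ε) ^ 10 ≤ (1 + 1 / (6 * r)) ^ N := by
  have hr0 : 0 < r := by linarith
  set δ := 1 / (6 * r) with hδ
  have hδ0 : 0 < δ := by positivity
  have hδ1 : δ ≤ 1 := by
    rw [hδ, div_le_one (by positivity)]; linarith
  have hexp : Real.exp (δ / 2) ≤ 1 + δ := by
    have h1 := Real.one_sub_le_exp_neg (δ / 2)
    rw [Real.exp_neg] at h1
    have h2 : 0 < Real.exp (δ / 2) := Real.exp_pos _
    have h3 : (1 - δ / 2) * Real.exp (δ / 2) ≤ 1 := by
      have := mul_le_mul_of_nonneg_right h1 h2.le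
      rwa [inv_mul_cancel₀ h2.ne'] at this
    have h4 : 0 ≤ δ / 2 * (1 - δ) * Real.exp (δ / 2) :=
      mul_nonneg (mul_nonneg (by positivity) (by linarith)) h2.le
    nlinarith
  have hlog : 0 ≤ Real.log (1 / ε) := Real.log_nonneg (by rw [le_div_iff₀ hε]; linarith)
  have hδN : 10 * Real.log (1 / ε) ≤ N * (δ / 2) := by
    have h1 : 120 * r * Real.log (1 / ε) ≤ N := by
      refine le_trans ?_ hN
      exact mul_le_mul_of_nonneg_right (by linarith) hlog
    rw [hδ]
    have h2 := mul_le_mul_of_nonneg_right h1 (show 0 ≤ 1 / (6 * r) / 2 by positivity)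
    refine le_trans (le_of_eq ?_) h2
    generalize Real.log (1 / ε) = t
    field_simp
    ring
  calc (1 / ε) ^ 10 = Real.exp (10 * Real.log (1 / ε)) := by
        rw [show (10 : ℝ) * Real.log (1 / ε) = ((10 : ℕ) : ℝ) * Real.log (1 / ε) by norm_num,
          Real.exp_nat_mul, Real.exp_log (by positivity)]
    _ ≤ Real.exp (N * (δ / 2)) := Real.exp_le_exp.2 hδN
    _ = Real.exp (δ / 2) ^ N := Real.exp_nat_mul _ _
    _ ≤ (1 + δ) ^ N := by gcongr

end Rate

/-! ### Choice of ε₀ and final accuracy -/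

/-- All distances are measured from a fixed feasible point v, as no bound uniform in μ is available.
The gradient is controlled by its Lipschitz constant. -/
theorem exists_regularized_bound {p d : ℕ} {K : Matrix (Fin p) (Fin d) ℝ}
    {c : EuclideanSpace ℝ (Fin p)} {h : EuclideanSpace ℝ (Fin d) → ℝ} {L : ℝ}
    (hc : c ∈ LinearMap.range (Matrix.toEuclideanLin K)) (hL : 0 < L)
    (hcv : ConvexOn ℝ Set.univ h) (hs : IsLSmooth L h) (u0 : EuclideanSpace ℝ (Fin d)) :
    ∃ G, 0 ≤ G ∧ ∀ μ, 0 < μ → μ ≤ 1 → ∀ x, IsAffineSolution (regularized h μ) K c x →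
      ‖u0 - x‖ ≤ G / μ ∧ ‖gradient h x‖ ≤ G / μ ∧ ‖gradient h x + μ • x‖ ≤ G / μ := by
  obtain ⟨v, hv⟩ := hc
  set g := ‖gradient h v‖ with hg
  set n := ‖v‖ with hn
  set m := ‖v - u0‖ with hm
  have hg0 : 0 ≤ g := norm_nonneg _
  have hn0 : 0 ≤ n := norm_nonneg _
  have hm0 : 0 ≤ m := norm_nonneg _
  obtain ⟨b, hb⟩ : ∃ b, b = 2 * (g + n) := ⟨_, rfl⟩
  have hb0 : 0 ≤ b := by rw [hb]; positivity
  have hLb : 0 ≤ L * b := by positivity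
  refine ⟨b + g + L * b + n + m, by positivity, fun μ hμ hμ1 x hx => ?_⟩
  have h1 : μ * ‖x - v‖ ≤ b := by
    have := hx.norm_sub_le_div hμ hμ1 hcv hs hv
    rw [← hg, ← hn, ← hb, le_div_iff₀ hμ] at this
    linarith
  have h2 : ‖u0 - x‖ ≤ m + ‖x - v‖ := by
    rw [norm_sub_rev u0 x, hm, add_comm]
    exact norm_sub_le_norm_sub_add_norm_sub _ _ _
  have h3 : ‖gradient h x‖ ≤ g + L * ‖x - v‖ := by
    have := hcv.norm_gradient_sub_le hL hs.1 hs.2 v x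
    have := norm_le_norm_add_norm_sub' (gradient h x) (gradient h v)
    linarith
  have h4 : ‖x‖ ≤ n + ‖x - v‖ := norm_le_norm_add_norm_sub' x v
  have h5 : ‖gradient h x + μ • x‖ ≤ ‖gradient h x‖ + μ * ‖x‖ := by
    refine (norm_add_le _ _).trans_eq ?_
    rw [norm_smul, Real.norm_of_nonneg hμ.le]
  have s1 : μ * m ≤ m := mul_le_of_le_one_left hm0 hμ1
  have s2 : μ * g ≤ g := mul_le_of_le_one_left hg0 hμ1
  have s3 : μ * n ≤ n := mul_le_of_le_one_left hn0 hμ1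
  have s4 : μ * ‖u0 - x‖ ≤ μ * (m + ‖x - v‖) := by gcongr
  have s5 : μ * ‖gradient h x‖ ≤ μ * (g + L * ‖x - v‖) := by gcongr
  have s6 : L * (μ * ‖x - v‖) ≤ L * b := by gcongr
  have s7 : μ * ‖x‖ ≤ μ * (n + ‖x - v‖) := by gcongr
  have s8 : μ * ‖gradient h x + μ • x‖ ≤ μ * (‖gradient h x‖ + μ * ‖x‖) := by gcongr
  have s9 : μ * (μ * ‖x‖) ≤ μ * ‖x‖ := mul_le_of_le_one_left (by positivity) hμ1
  refine ⟨?_, ?_, ?_⟩ <;> rw [le_div_iff₀ hμ, mul_comm] <;> linarith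

/-- The budget is ε/4 for the linear term of the smoothness bound, ε/4 for the quadratic one and ε/2
for the regularization. -/
theorem IsAffineSolution.sub_le_of_regularized {p d : ℕ} {K : Matrix (Fin p) (Fin d) ℝ}
    {c : EuclideanSpace ℝ (Fin p)} {h : EuclideanSpace ℝ (Fin d) → ℝ} {L ε R G : ℝ}
    (hL : 0 < L) (hε : 0 < ε) (hε1 : ε ≤ 1) (hR : 0 < R) (hG : 4 * G * R ^ 2 * ε ≤ 1)
    (hLε : 2 * L * ε ≤ 1) (hs : IsLSmooth L h) {x w z : EuclideanSpace ℝ (Fin d)}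
    (hx : IsAffineSolution (regularized h (ε / R ^ 2)) K c x)
    (hg : ‖gradient h x‖ ≤ G / (ε / R ^ 2)) (hw : ‖w - x‖ ^ 2 ≤ ε ^ 6)
    (hz : Matrix.toEuclideanLin K z = c) (hzR : ‖z‖ ^ 2 ≤ R ^ 2) : h w - h z ≤ ε := by
  have h1 := hs.2 x w
  have h2 : ‖w - x‖ ≤ ε ^ 3 :=
    abs_le_of_sq_le_sq' (by rw [← pow_mul]; exact hw) (by positivity) |>.2
  have h3 : inner ℝ (gradient h x) (w - x) ≤ ε / 4 := by
    calc inner ℝ (gradient h x) (w - x) ≤ ‖gradient h x‖ * ‖w - x‖ := real_inner_le_norm _ _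
      _ ≤ G / (ε / R ^ 2) * ε ^ 3 :=
        mul_le_mul hg h2 (norm_nonneg _) ((norm_nonneg _).trans hg)
      _ = (4 * G * R ^ 2 * ε) * (ε / 4) := by field_simp
      _ ≤ 1 * (ε / 4) := by gcongr
      _ = ε / 4 := one_mul _
  have h4 : L / 2 * ‖w - x‖ ^ 2 ≤ ε / 4 := by
    calc L / 2 * ‖w - x‖ ^ 2 ≤ L / 2 * ε ^ 6 := by gcongr
      _ ≤ L / 2 * ε ^ 2 := by
        gcongr ?_ * ?_
        exact pow_le_pow_of_le_one hε.le hε1 (by norm_num)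
      _ = (2 * L * ε) * (ε / 4) := by ring
      _ ≤ 1 * (ε / 4) := by gcongr
      _ = ε / 4 := one_mul _
  have h5 := hx.2 z hz
  unfold regularized at h5
  have h6 : ε / R ^ 2 * ‖z‖ ^ 2 ≤ ε := by
    calc ε / R ^ 2 * ‖z‖ ^ 2 ≤ ε / R ^ 2 * R ^ 2 := by gcongr
      _ = ε := by field_simp
  have h7 : 0 ≤ ε / R ^ 2 * ‖x‖ ^ 2 := by positivity
  linarith

theorem apapcIterate_error_le {p d : ℕ} {K : Matrix (Fin p) (Fin d) ℝ}
    {c : EuclideanSpace ℝ (Fin p)} {h : EuclideanSpace ℝ (Fin d) → ℝ} {L ε R G : ℝ}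
    (hK : K ≠ 0) (hL : 0 < L) (hε : 0 < ε) (hε1 : ε < 1) (hR : 0 < R)
    (hμ1 : ε / R ^ 2 ≤ 1) (hκ : condNumber K * (ε / R ^ 2) ≤ L)
    (hD : (2 + 1 / L + L) * G ^ 2 * R ^ 6 * ε ≤ 1)
    (hcv : ConvexOn ℝ Set.univ h) (hs : IsLSmooth L h) {x u0 : EuclideanSpace ℝ (Fin d)}
    (hx : IsAffineSolution (regularized h (ε / R ^ 2)) K c x)
    (hu0 : ‖u0 - x‖ ≤ G / (ε / R ^ 2))
    (hg : ‖gradient h x + (ε / R ^ 2) • x‖ ≤ G / (ε / R ^ 2)) {N : ℕ}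
    (hN : 180 * Real.sqrt (condNumber K * L * R ^ 2 / ε) * Real.log (1 / ε) ≤ N) :
    ‖apapcIterate (regularized h (ε / R ^ 2)) K c (L + ε / R ^ 2) (ε / R ^ 2) u0 N - x‖ ^ 2
      ≤ ε ^ 6 := by
  obtain ⟨μ, hμd⟩ : ∃ μ, μ = ε / R ^ 2 := ⟨_, rfl⟩
  have hs2 : condNumber K * L * R ^ 2 / ε = condNumber K * (L / μ) := by
    rw [hμd]; field_simp
  have hμR : G ^ 2 / μ ^ 3 = G ^ 2 * R ^ 6 / ε ^ 3 := by
    rw [hμd]; field_simp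
  rw [hs2] at hN
  have hμ : 0 < μ := by rw [hμd]; positivity
  rw [← hμd] at hμ1 hκ hx hu0 hg ⊢
  have hκ1 := one_le_condNumber hK
  set k := condNumber K
  have hμL : μ ≤ L := by nlinarith
  have hP : 0 < k * ((L + μ) / μ) := by positivity
  set r := Real.sqrt (k * ((L + μ) / μ)) with hr
  have hr2 : r ^ 2 = k * ((L + μ) / μ) := Real.sq_sqrt hP.le
  have hr0 : 0 < r := Real.sqrt_pos.2 hP
  have hκr : k ≤ r := by
    apply Real.le_sqrt_of_sq_le
    rw [sq]
    gcongr
    rw [le_div_iff₀ hμ]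
    linarith
  -- Since μ ≤ L, (L + μ)/μ ≤ 2L/μ, and 2 ≤ (3/2)².
  have hrs : r ≤ 3 / 2 * Real.sqrt (k * (L / μ)) := by
    apply Real.sqrt_le_iff.2 ⟨by positivity, ?_⟩
    rw [mul_pow, Real.sq_sqrt (by positivity)]
    have : (L + μ) / μ ≤ 9 / 4 * (L / μ) := by
      rw [← mul_div_assoc]
      gcongr
      linarith
    calc k * ((L + μ) / μ) ≤ k * (9 / 4 * (L / μ)) := by gcongr
      _ = _ := by ring
  have hpow := inv_pow_le_one_add_pow hε hε1 (hκ1.trans hκr) hrs hN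
  have hconv := apapcIterate_linear_convergence hK hL hμ hμL hcv hs hx hr0 hr2 hκr u0 N
  set a := ‖apapcIterate (regularized h μ) K c (L + μ) μ u0 N - x‖ ^ 2
  have ha : 0 ≤ a := sq_nonneg _
  have hV : 2 * ‖u0 - x‖ ^ 2 + ‖gradient h x + μ • x‖ ^ 2 / (μ * L) + L / μ * ‖u0 - x‖ ^ 2
      ≤ (2 + 1 / L + L) * (G ^ 2 / μ ^ 3) := by
    calc _ ≤ 2 * (G / μ) ^ 2 + (G / μ) ^ 2 / (μ * L) + L / μ * (G / μ) ^ 2 := by gcongr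
      _ = (2 * μ + 1 / L + L) * (G ^ 2 / μ ^ 3) := by field_simp
      _ ≤ _ := by gcongr; linarith
  have hfin : (1 / ε) ^ 10 * a ≤ (2 + 1 / L + L) * (G ^ 2 * R ^ 6 / ε ^ 3) := by
    rw [← hμR]
    exact (mul_le_mul_of_nonneg_right hpow ha).trans (hconv.trans hV)
  -- Of ε¹⁰, three powers cancel ε⁻³ and one absorbs the constant through `hD`.
  calc a = ε ^ 10 * ((1 / ε) ^ 10 * a) := by field_simp
    _ ≤ ε ^ 10 * ((2 + 1 / L + L) * (G ^ 2 * R ^ 6 / ε ^ 3)) := by gcongr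
    _ = ((2 + 1 / L + L) * G ^ 2 * R ^ 6 * ε) * ε ^ 6 := by field_simp
    _ ≤ 1 * ε ^ 6 := by gcongr
    _ = ε ^ 6 := one_mul _

theorem mainTheorem5 :
    ∃ C : ℝ, 0 < C ∧
      ∀ (d p : ℕ) (K : Matrix (Fin p) (Fin d) ℝ) (c : EuclideanSpace ℝ (Fin p))
        (h : EuclideanSpace ℝ (Fin d) → ℝ) (L R : ℝ) (u0 : EuclideanSpace ℝ (Fin d)),
        K ≠ 0 →
        c ∈ LinearMap.range (Matrix.toEuclideanLin K) →
        0 < L → 0 < R →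
        ConvexOn ℝ Set.univ h →
        IsLSmooth L h →
        ∃ ε₀ : ℝ, 0 < ε₀ ∧ ∀ ε : ℝ, 0 < ε → ε < ε₀ →
          ∃ uμ : EuclideanSpace ℝ (Fin d),
            (∀ v, IsAffineSolution (regularized h (ε / R ^ 2)) K c v ↔ v = uμ) ∧
            ∀ N : ℕ,
              C * Real.sqrt (condNumber K * L * R ^ 2 / ε) * Real.log (1 / ε) ≤ N →
              ‖apapcIterate (regularized h (ε / R ^ 2)) K c
                  (L + ε / R ^ 2) (ε / R ^ 2) u0 N - uμ‖ ^ 2 ≤ ε ∧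
              ∀ uStar, IsAffineSolution h K c uStar → ‖uStar‖ ^ 2 ≤ R ^ 2 →
                h (apapcIterate (regularized h (ε / R ^ 2)) K c
                  (L + ε / R ^ 2) (ε / R ^ 2) u0 N) - h uStar ≤ ε := by
  refine ⟨180, by norm_num, fun d p K c h L R u0 hK hc hL hR hcv hs => ?_⟩
  obtain ⟨G, hG0, hG⟩ := exists_regularized_bound hc hL hcv hs u0
  have hκ1 := one_le_condNumber hK
  have hκ0 : 0 ≤ condNumber K / (L * R ^ 2) := by positivity
  have hR0 : 0 ≤ 1 / R ^ 2 := by positivity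
  have hD0 : 0 ≤ (2 + 1 / L + L) * G ^ 2 * R ^ 6 := by positivity
  have hGR0 : 0 ≤ 4 * G * R ^ 2 := by positivity
  -- Each smallness requirement on ε has the form aε ≤ 1 with a ≥ 0; T sums these a, so ε < 1/T
  -- meets them all.
  obtain ⟨T, hT⟩ : ∃ T, T = 1 + 1 / R ^ 2 + condNumber K / (L * R ^ 2)
    + (2 + 1 / L + L) * G ^ 2 * R ^ 6 + 4 * G * R ^ 2 + 2 * L := ⟨_, rfl⟩
  have hT0 : 0 < T := by rw [hT]; positivity
  refine ⟨1 / T, by positivity, fun ε hε hεT => ?_⟩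
  rw [lt_div_iff₀ hT0] at hεT
  have hsmall : ∀ a, a ≤ T → a * ε ≤ 1 := fun a ha => by nlinarith
  have hε1 : ε < 1 := by nlinarith
  have hμ : 0 < ε / R ^ 2 := by positivity
  have hμ1 : ε / R ^ 2 ≤ 1 := by
    rw [div_eq_mul_one_div, mul_comm]
    exact hsmall _ (by linarith)
  have hκ : condNumber K * (ε / R ^ 2) ≤ L := by
    have := mul_le_mul_of_nonneg_left (hsmall (condNumber K / (L * R ^ 2)) (by linarith)) hL.le
    rw [mul_one] at this
    refine le_trans (le_of_eq ?_) this
    field_simp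
  obtain ⟨x, hx⟩ := exists_isAffineSolution_regularized hμ hc hcv hs
  refine ⟨x, fun v => ⟨fun hv => hx.eq_of_regularized hL hμ hcv hs hv, fun hv => hv ▸ hx⟩,
    fun N hN => ?_⟩
  obtain ⟨hu0, hg, hgx⟩ := hG _ hμ hμ1 x hx
  have herr := apapcIterate_error_le hK hL hε hε1 hR hμ1 hκ (hsmall _ (by linarith)) hcv hs hx
    hu0 hgx hN
  refine ⟨herr.trans (pow_le_of_le_one hε.le hε1.le (by norm_num)), fun z hz hzR => ?_⟩
  exact hx.sub_le_of_regularized hL hε hε1.le hR (hsmall _ (by linarith))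
    (hsmall _ (by linarith)) hs hg herr hz.1 hzR
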